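/- Let $R$ be a commutative ring, let $C$ be an $R$-coalgebra (coassociative and counital, with comultiplication $c\mapsto\sum c_1\otimes c_2$ and counit $\varepsilon$), and let $A$ be an associative $R$-algebra, not necessarily with unity. Let $\kappa:A\to C^*=\mathrm{Hom}_R(C,R)$ be a morphism of (not necessarily unital) $R$-algebras, where $C^*$ carries the convolution product $(f\star g)(c)=\sum f(c_1)g(c_2)$; that is, $P=(A,C)$ is a measuring $R$-pairing. Write $\langle a,c\rangle=\kappa(a)(c)$. **Conventions.** A left $A$-module is an $R$-module $M$ with an $R$-bilinear associative action of $A$. It is *$A$-faithful* if $\rho_M:M\to\mathrm{Hom}_R(A,M)$, $m\mapsto(a\mapsto am)$, is injective, and *unital* if $AM=M$, where $AM$ is the submodule spanned by all $am$. Let $$\alpha_M:M\otimes_RC\to\mathrm{Hom}_R(A,M),\qquad m\otimes c\mapsto(a\mapsto\langle a,c\rangle m).$$ $M$ is *$C$-rational* if $\rho_M(M)\subseteq\alpha_M(M\otimes_RC)$. Write $\mathrm{Rat}^C({}_A\widetilde{\mathcal M})$ (resp. $\mathrm{Rat}^C({}_A\mathcal M)$) for the category of $A$-faithful (resp. unital)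 $C$-rational left $A$-modules and $A$-linear maps. $C$ is a left $A$-module via $a\rightharpoonup c=\sum c_1\langle a,c_2\rangle$ and a right $A$-module via $c\leftharpoonup a=\sum\langle a,c_1\rangle c_2$; $\sigma[{}_AC]$ is the category of all left $A$-modules that are isomorphic to a submodule of a quotient of a direct sum of copies of ${}_AC$, with $A$-linear maps. $\mathcal M^C$ is the category of right $C$-comodules $(M,\varrho_M)$ that are coassociative and *counital*, i.e. $\varrho_M:M\to M\otimes_RC$ is injective (equivalently, $(\mathrm{id}\otimes\varepsilon)\varrho_M=\mathrm{id}$), with colinear maps. Right modules, left comodules and the categories ${}^C\mathcal M$, ${}^C\mathrm{Rat}(\widetilde{\mathcal M}_A)$, ${}^C\mathrm{Rat}(\mathcal M_A)$, $\sigma[C_A]$ are treated symmetrically. The same notions with $C^*$ in place of $A$ refer to the measuring pairing $(C^*,C)$ with $\kappa=\mathrm{id}$. An $R$-module $W$ is *locally projective* if for every surjective $R$-linear map $g:L\to N$, every $R$-linear map $f:W\to N$ and every finitely generated submodule $F\subseteq W$ there is an $R$-linear map $h:W\to L$ with $gh|_F=f|_F$. The *finite topology* on $C^*$ is the one induced from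 the product topology on $R^C$, with $R$ discrete. **Theorem.** Assume that ${}_RC$ is locally projective and that $\kappa(A)\subseteq C^*$ is dense in the finite topology. Then every counital right (resp. left) $C$-comodule is a unital left (resp. right) $A$-module via $am=\sum m_0\langle a,m_1\rangle$ (resp. $ma=\sum\langle a,m_{-1}\rangle m_0$), and there are isomorphisms of categories $\simeq$ and equalities of full subcategories $$\mathcal M^C\simeq\mathrm{Rat}^C({}_A\widetilde{\mathcal M})=\mathrm{Rat}^C({}_A\mathcal M)=\sigma[{}_AC]\simeq\mathrm{Rat}^C({}_{C^*}\widetilde{\mathcal M})=\mathrm{Rat}^C({}_{C^*}\mathcal M)=\sigma[{}_{C^*}C]$$ and $${}^C\mathcal M\simeq{}^C\mathrm{Rat}(\widetilde{\mathcal M}_A)={}^C\mathrm{Rat}(\mathcal M_A)=\sigma[C_A]\simeq{}^C\mathrm{Rat}(\widetilde{\mathcal M}_{C^*})={}^C\mathrm{Rat}(\mathcal M_{C^*})=\sigma[C_{C^*}].$$ More precisely, the functor $(M,\varrho_M)\mapsto(M,\alpha_M\circ\varrho_M)$, which is the identity on underlying $R$-linear maps, is an isomorphism from $\mathcal M^C$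 onto $\mathrm{Rat}^C({}_A\widetilde{\mathcal M})$ and, with $C^*$ in place of $A$, onto $\mathrm{Rat}^C({}_{C^*}\widetilde{\mathcal M})$; restriction of the action along $\kappa$ is an isomorphism from $\mathrm{Rat}^C({}_{C^*}\widetilde{\mathcal M})$ onto $\mathrm{Rat}^C({}_A\widetilde{\mathcal M})$; and likewise on the other side. -/

import Mathlib

open CategoryTheory TensorProduct

universe u v₁ v₂ w w₁ w₂

noncomputable section

namespace MeasuringPairing

section LocallyProjective

/-- Local projectivity in the sense of Zimmermann-Huisgen: maps out of `W` lift along surjections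
on every finitely generated submodule of `W`. -/
def IsLocallyProjective (R : Type u) (W : Type v₁) [CommRing R] [AddCommGroup W] [Module R W] :
    Prop :=
  ∀ (L N : Type (max u v₁)) [AddCommGroup L] [Module R L] [AddCommGroup N] [Module R N]
    (g : L →ₗ[R] N) (f : W →ₗ[R] N) (F : Submodule R W),
    Function.Surjective g → F.FG → ∃ h : W →ₗ[R] L, ∀ x ∈ F, g (h x) = f x

end LocallyProjective

section CategoryIso

/-- `F` is an isomorphism of categories: it has a strict two-sided inverse. -/
def IsCategoryIso {𝒞 : Type*} {𝒟 : Type*} [Category 𝒞] [Category 𝒟] (F : 𝒞 ⥤ 𝒟) : Prop :=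
  ∃ G : 𝒟 ⥤ 𝒞, F ⋙ G = 𝟭 𝒞 ∧ G ⋙ F = 𝟭 𝒟

end CategoryIso

/-! ### Modules over a not necessarily unital algebra -/

section Modules

variable (R : Type u) (A : Type v₁) [CommRing R] [NonUnitalRing A] [Module R A]

/-- Left modules over a not necessarily unital `R`-algebra `A`: `R`-modules `M` with an
`R`-bilinear associative action `act a m = a m`. -/
structure LeftMod where
  carrier : Type w
  [addCommGroup : AddCommGroup carrier]
  [module : Module R carrier]
  act : A →ₗ[R] carrier →ₗ[R] carrier
  mul_act : ∀ (a b : A) (m : carrier), act (a * b) m = act a (act b m)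

/-- Right modules over a not necessarily unital `R`-algebra `A`; here `act a m = m a`. -/
structure RightMod where
  carrier : Type w
  [addCommGroup : AddCommGroup carrier]
  [module : Module R carrier]
  act : A →ₗ[R] carrier →ₗ[R] carrier
  act_mul : ∀ (a b : A) (m : carrier), act (a * b) m = act b (act a m)

attribute [instance] LeftMod.addCommGroup LeftMod.module RightMod.addCommGroup RightMod.module

variable {R A}

namespace LeftMod

/-- `A`-linear maps of left `A`-modules. -/
@[ext]
structure Hom (M : LeftMod.{u, v₁, w₁} R A) (N : LeftMod.{u, v₁, w₂} R A) where
  toLin : M.carrier →ₗ[R] N.carrier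
  map_act : ∀ (a : A) (m : M.carrier), toLin (M.act a m) = N.act a (toLin m)

instance : Category.{w} (LeftMod.{u, v₁, w} R A) where
  Hom M N := Hom M N
  id M := ⟨LinearMap.id, fun _ _ => rfl⟩
  comp f g := ⟨g.toLin ∘ₗ f.toLin, fun a m => by simp [f.map_act, g.map_act]⟩

/-- The canonical map `ρ : M → Hom_R(A, M)`, `m ↦ (a ↦ a m)`. -/
def rho (M : LeftMod.{u, v₁, w} R A) : M.carrier →ₗ[R] A →ₗ[R] M.carrier := M.act.flip

/-- `M` is `A`-faithful. -/
def IsAFaithful (M : LeftMod.{u, v₁, w} R A) : Prop := Function.Injective M.rho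

/-- `M` is unital: `A M = M`. -/
def IsUnital (M : LeftMod.{u, v₁, w} R A) : Prop :=
  Submodule.span R {x : M.carrier | ∃ (a : A) (m : M.carrier), M.act a m = x} = ⊤

/-- The direct sum of copies of `K` indexed by `Λ`. -/
def copower (Λ : Type w₂) (K : LeftMod.{u, v₁, w₁} R A) : LeftMod.{u, v₁, max w₁ w₂} R A where
  carrier := Λ →₀ K.carrier
  act := LinearMap.mk₂ R (fun a x => Finsupp.mapRange.linearMap (K.act a) x)
    (fun a b x => by ext; simp) (fun r a x => by ext; simp) (fun a x y => map_add _ x y)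
    (fun r a x => map_smul _ r x)
  mul_act a b x := by
    ext i
    simp [K.mul_act]

/-- `N` is `K`-subgenerated: it embeds into a quotient `Q` of a direct sum of copies of `K`. -/
def IsSubgenerated (K : LeftMod.{u, v₁, w₁} R A) (N : LeftMod.{u, v₁, w} R A) : Prop :=
  ∃ (Q : LeftMod.{u, v₁, max w₁ w} R A) (Λ : Type (max w₁ w))
    (p : Hom (copower Λ K) Q) (i : Hom N Q),
    Function.Surjective p.toLin ∧ Function.Injective i.toLin

/-- The full subcategory `σ[K]` of `K`-subgenerated modules. Unitality is not imposed on them. -/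
def sigma (K : LeftMod.{u, v₁, w₁} R A) : ObjectProperty (LeftMod.{u, v₁, w} R A) :=
  fun N => IsSubgenerated K N

/-- Restriction of the action along an algebra morphism. -/
def restrict {B : Type v₂} [NonUnitalRing B] [Module R B] (φ : A →ₙₐ[R] B) :
    LeftMod.{u, v₂, w} R B ⥤ LeftMod.{u, v₁, w} R A where
  obj M :=
    { carrier := M.carrier
      act := M.act ∘ₗ (φ : A →ₗ[R] B)
      mul_act := fun a b m => by simp [M.mul_act] }
  map f := ⟨f.toLin, fun a m => f.map_act (φ a) m⟩

end LeftMod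

namespace RightMod

/-- `A`-linear maps of right `A`-modules. -/
@[ext]
structure Hom (M : RightMod.{u, v₁, w₁} R A) (N : RightMod.{u, v₁, w₂} R A) where
  toLin : M.carrier →ₗ[R] N.carrier
  map_act : ∀ (a : A) (m : M.carrier), toLin (M.act a m) = N.act a (toLin m)

instance : Category.{w} (RightMod.{u, v₁, w} R A) where
  Hom M N := Hom M N
  id M := ⟨LinearMap.id, fun _ _ => rfl⟩
  comp f g := ⟨g.toLin ∘ₗ f.toLin, fun a m => by simp [f.map_act, g.map_act]⟩

/-- The canonical map `ρ : M → Hom_R(A, M)`, `m ↦ (a ↦ m a)`. -/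
def rho (M : RightMod.{u, v₁, w} R A) : M.carrier →ₗ[R] A →ₗ[R] M.carrier := M.act.flip

/-- `M` is `A`-faithful. -/
def IsAFaithful (M : RightMod.{u, v₁, w} R A) : Prop := Function.Injective M.rho

/-- `M` is unital: `M A = M`. -/
def IsUnital (M : RightMod.{u, v₁, w} R A) : Prop :=
  Submodule.span R {x : M.carrier | ∃ (a : A) (m : M.carrier), M.act a m = x} = ⊤

/-- The direct sum of copies of `K` indexed by `Λ`. -/
def copower (Λ : Type w₂) (K : RightMod.{u, v₁, w₁} R A) : RightMod.{u, v₁, max w₁ w₂} R A where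
  carrier := Λ →₀ K.carrier
  act := LinearMap.mk₂ R (fun a x => Finsupp.mapRange.linearMap (K.act a) x)
    (fun a b x => by ext; simp) (fun r a x => by ext; simp) (fun a x y => map_add _ x y)
    (fun r a x => map_smul _ r x)
  act_mul a b x := by
    ext i
    simp [K.act_mul]

/-- `N` is `K`-subgenerated: it embeds into a quotient `Q` of a direct sum of copies of `K`. -/
def IsSubgenerated (K : RightMod.{u, v₁, w₁} R A) (N : RightMod.{u, v₁, w} R A) : Prop :=
  ∃ (Q : RightMod.{u, v₁, max w₁ w} R A) (Λ : Type (max w₁ w))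
    (p : Hom (copower Λ K) Q) (i : Hom N Q),
    Function.Surjective p.toLin ∧ Function.Injective i.toLin

/-- The full subcategory `σ[K]` of `K`-subgenerated modules. Unitality is not imposed on them. -/
def sigma (K : RightMod.{u, v₁, w₁} R A) : ObjectProperty (RightMod.{u, v₁, w} R A) :=
  fun N => IsSubgenerated K N

/-- Restriction of the action along an algebra morphism. -/
def restrict {B : Type v₂} [NonUnitalRing B] [Module R B] (φ : A →ₙₐ[R] B) :
    RightMod.{u, v₂, w} R B ⥤ RightMod.{u, v₁, w} R A where
  obj M :=
    { carrier := M.carrier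
      act := M.act ∘ₗ (φ : A →ₗ[R] B)
      act_mul := fun a b m => by simp [M.act_mul] }
  map f := ⟨f.toLin, fun a m => f.map_act (φ a) m⟩

end RightMod

end Modules

/-! ### Comodules -/

section Comodules

variable (R : Type u) (C : Type v₂) [CommRing R] [AddCommGroup C] [Module R C] [Coalgebra R C]

/-- Counital right `C`-comodules: the coaction is coassociative and injective. Injectivity is
equivalent to the counit law `(id ⊗ ε) ∘ ϱ = id`, see `RightComod.counit_coact`. -/
structure RightComod where
  carrier : Type w
  [addCommGroup : AddCommGroup carrier]
  [module : Module R carrier]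
  coact : carrier →ₗ[R] carrier ⊗[R] C
  coassoc : ∀ m : carrier, TensorProduct.assoc R carrier C C (coact.rTensor C (coact m)) =
    (Coalgebra.comul (R := R) (A := C)).lTensor carrier (coact m)
  injective_coact : Function.Injective coact

/-- Counital left `C`-comodules. -/
structure LeftComod where
  carrier : Type w
  [addCommGroup : AddCommGroup carrier]
  [module : Module R carrier]
  coact : carrier →ₗ[R] C ⊗[R] carrier
  coassoc : ∀ m : carrier, TensorProduct.assoc R C C carrier
      ((Coalgebra.comul (R := R) (A := C)).rTensor carrier (coact m)) =
    coact.lTensor C (coact m)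
  injective_coact : Function.Injective coact

attribute [instance] RightComod.addCommGroup RightComod.module
  LeftComod.addCommGroup LeftComod.module

variable {R C}

namespace RightComod

/-- `C`-colinear maps of right `C`-comodules. -/
@[ext]
structure Hom (M : RightComod.{u, v₂, w} R C) (N : RightComod.{u, v₂, w} R C) where
  toLin : M.carrier →ₗ[R] N.carrier
  map_coact : ∀ m : M.carrier, N.coact (toLin m) = toLin.rTensor C (M.coact m)

instance : Category.{w} (RightComod.{u, v₂, w} R C) where
  Hom M N := Hom M N
  id M := ⟨LinearMap.id, fun _ => by simp⟩
  comp f g := ⟨g.toLin ∘ₗ f.toLin, fun m => by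
    simp [f.map_coact, g.map_coact, LinearMap.rTensor_comp]⟩

/-- The counit law of a counital comodule. -/
theorem counit_coact (M : RightComod.{u, v₂, w} R C) (m : M.carrier) :
    TensorProduct.rid R M.carrier
      ((Coalgebra.counit (R := R) (A := C)).lTensor M.carrier (M.coact m)) = m := by
  apply M.injective_coact
  have key : ∀ t : M.carrier ⊗[R] C, M.coact (TensorProduct.rid R M.carrier
      ((Coalgebra.counit (R := R) (A := C)).lTensor M.carrier t)) =
      TensorProduct.rid R _ ((Coalgebra.counit (R := R) (A := C)).lTensor _
        (M.coact.rTensor C t)) := by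
    intro t
    induction t with
    | zero => simp
    | tmul x c => simp
    | add x y hx hy => simp only [map_add, hx, hy]
  have key2 : ∀ s : M.carrier ⊗[R] C, TensorProduct.rid R _
      ((Coalgebra.counit (R := R) (A := C)).lTensor _ ((TensorProduct.assoc R M.carrier C C).symm
        ((Coalgebra.comul (R := R) (A := C)).lTensor M.carrier s))) = s := by
    intro s
    induction s with
    | zero => simp
    | tmul x c =>
      have h : ∀ d : C ⊗[R] C, TensorProduct.rid R (M.carrier ⊗[R] C)
          ((Coalgebra.counit (R := R) (A := C)).lTensor _
            ((TensorProduct.assoc R M.carrier C C).symm (x ⊗ₜ[R] d))) =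
          x ⊗ₜ[R] (TensorProduct.rid R C ((Coalgebra.counit (R := R) (A := C)).lTensor C d)) := by
        intro d
        induction d with
        | zero => simp
        | tmul y z => simp
        | add y z hy hz => simp only [TensorProduct.tmul_add, map_add, hy, hz]
      rw [LinearMap.lTensor_tmul, h]
      simp
    | add x y hx hy => simp only [map_add, hx, hy]
  rw [key, ← (TensorProduct.assoc R M.carrier C C).symm_apply_apply (M.coact.rTensor C _),
    M.coassoc, key2]

/-- `C` as a right comodule over itself. -/
def regular (R : Type u) (C : Type v₂) [CommRing R] [AddCommGroup C] [Module R C]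
    [Coalgebra R C] : RightComod.{u, v₂, v₂} R C where
  carrier := C
  coact := Coalgebra.comul
  coassoc c := by simp
  injective_coact := fun x y h => by
    have h' := congrArg (fun t => TensorProduct.rid R C
      ((Coalgebra.counit (R := R) (A := C)).lTensor C t)) h
    simpa using h'

end RightComod

namespace LeftComod

/-- `C`-colinear maps of left `C`-comodules. -/
@[ext]
structure Hom (M : LeftComod.{u, v₂, w} R C) (N : LeftComod.{u, v₂, w} R C) where
  toLin : M.carrier →ₗ[R] N.carrier
  map_coact : ∀ m : M.carrier, N.coact (toLin m) = toLin.lTensor C (M.coact m)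

instance : Category.{w} (LeftComod.{u, v₂, w} R C) where
  Hom M N := Hom M N
  id M := ⟨LinearMap.id, fun _ => by simp⟩
  comp f g := ⟨g.toLin ∘ₗ f.toLin, fun m => by
    simp [f.map_coact, g.map_coact, LinearMap.lTensor_comp]⟩

/-- `C` as a left comodule over itself. -/
def regular (R : Type u) (C : Type v₂) [CommRing R] [AddCommGroup C] [Module R C]
    [Coalgebra R C] : LeftComod.{u, v₂, v₂} R C where
  carrier := C
  coact := Coalgebra.comul
  coassoc c := by simp
  injective_coact := fun x y h => by
    have h' := congrArg (fun t => TensorProduct.lid R C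
      ((Coalgebra.counit (R := R) (A := C)).rTensor C t)) h
    simpa using h'

end LeftComod

end Comodules

/-! ### Measuring pairings -/

section Pairings

variable {R : Type u} {A : Type v₁} {C : Type v₂} [CommRing R] [NonUnitalRing A] [Module R A]
  [AddCommGroup C] [Module R C] [Coalgebra R C]

/-- The dual `C*` with the convolution product `(f ⋆ g)(c) = ∑ f(c₁) g(c₂)`. -/
abbrev ConvDual (R : Type u) (C : Type v₂) [CommRing R] [AddCommGroup C] [Module R C] :
    Type (max u v₂) := WithConv (C →ₗ[R] R)

/-- The pairing `⟨a, c⟩ = κ(a)(c)` of a measuring pairing `κ : A → C*`. -/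
def pair (κ : A →ₙₐ[R] ConvDual R C) : A →ₗ[R] C →ₗ[R] R where
  toFun a := (κ a).ofConv
  map_add' a b := by simp
  map_smul' r a := by simp

/-- The finite topology on `C*`: the topology induced by `C* ⊆ R^C`, where `R` is discrete and
`R^C` carries the product topology. -/
abbrev finiteTopology (R : Type u) (C : Type v₂) [CommRing R] [AddCommGroup C] [Module R C] :
    TopologicalSpace (ConvDual R C) :=
  TopologicalSpace.induced (fun (f : ConvDual R C) (c : C) => f.ofConv c)
    (@Pi.topologicalSpace C (fun _ => R) (fun _ => ⊥))

/-- `κ(A)` is dense in `C*` for the finite topology. -/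
def HasDenseRange (κ : A →ₙₐ[R] ConvDual R C) : Prop :=
  @Dense (ConvDual R C) (finiteTopology R C) (Set.range κ)

/-- The map `α_M : M ⊗ C → Hom_R(A, M)`, `m ⊗ c ↦ (a ↦ ⟨a, c⟩ m)`. -/
def alphaRight (κ : A →ₙₐ[R] ConvDual R C) (M : Type w) [AddCommGroup M] [Module R M] :
    M ⊗[R] C →ₗ[R] A →ₗ[R] M :=
  TensorProduct.lift (LinearMap.mk₂ R
    (fun (m : M) (c : C) => (LinearMap.toSpanSingleton R M m) ∘ₗ (pair κ).flip c)
    (fun m m' c => by ext; simp) (fun r m c => by ext a; exact smul_comm _ _ _)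
    (fun m c c' => by ext; simp [add_smul]) (fun r m c => by ext; simp [mul_smul]))

/-- The map `C ⊗ M → Hom_R(A, M)`, `c ⊗ m ↦ (a ↦ ⟨a, c⟩ m)`. -/
def alphaLeft (κ : A →ₙₐ[R] ConvDual R C) (M : Type w) [AddCommGroup M] [Module R M] :
    C ⊗[R] M →ₗ[R] A →ₗ[R] M :=
  alphaRight κ M ∘ₗ (TensorProduct.comm R C M).toLinearMap

variable (κ : A →ₙₐ[R] ConvDual R C)

@[simp]
theorem alphaRight_tmul (M : Type w) [AddCommGroup M] [Module R M] (m : M) (c : C) (a : A) :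
    alphaRight κ M (m ⊗ₜ[R] c) a = pair κ a c • m := rfl

@[simp]
theorem alphaLeft_tmul (M : Type w) [AddCommGroup M] [Module R M] (m : M) (c : C) (a : A) :
    alphaLeft κ M (c ⊗ₜ[R] m) a = pair κ a c • m := rfl

theorem pair_mul (a b : A) (c : C) :
    pair κ (a * b) c = LinearMap.mul' R R
      (TensorProduct.map (pair κ a) (pair κ b) (Coalgebra.comul (R := R) c)) := by
  simp only [pair, LinearMap.coe_mk, AddHom.coe_mk, map_mul]
  rfl

theorem alphaRight_map {M : Type w} [AddCommGroup M] [Module R M] {N : Type w} [AddCommGroup N]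
    [Module R N] (f : M →ₗ[R] N) (t : M ⊗[R] C) (a : A) :
    alphaRight κ N (f.rTensor C t) a = f (alphaRight κ M t a) := by
  induction t with
  | zero => simp
  | tmul x c => simp
  | add x y hx hy => simp only [map_add, LinearMap.add_apply, hx, hy]

theorem alphaLeft_map {M : Type w} [AddCommGroup M] [Module R M] {N : Type w} [AddCommGroup N]
    [Module R N] (f : M →ₗ[R] N) (t : C ⊗[R] M) (a : A) :
    alphaLeft κ N (f.lTensor C t) a = f (alphaLeft κ M t a) := by
  induction t with
  | zero => simp
  | tmul c x => simp
  | add x y hx hy => simp only [map_add, LinearMap.add_apply, hx, hy]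

theorem alphaRight_mul (M : RightComod.{u, v₂, w} R C) (a b : A) (m : M.carrier) :
    alphaRight κ M.carrier (M.coact m) (a * b) =
      alphaRight κ M.carrier (M.coact (alphaRight κ M.carrier (M.coact m) b)) a := by
  let T : M.carrier ⊗[R] (C ⊗[R] C) →ₗ[R] M.carrier :=
    (TensorProduct.rid R M.carrier).toLinearMap ∘ₗ
      (LinearMap.mul' R R ∘ₗ TensorProduct.map (pair κ a) (pair κ b)).lTensor M.carrier
  have h1 : ∀ t : M.carrier ⊗[R] C, T ((Coalgebra.comul (R := R) (A := C)).lTensor M.carrier t) =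
      alphaRight κ M.carrier t (a * b) := by
    intro t
    induction t with
    | zero => simp
    | tmul x c => simp [T, pair_mul]
    | add x y hx hy => simp only [map_add, LinearMap.add_apply, hx, hy]
  have h2 : ∀ (s : M.carrier ⊗[R] C) (c : C), T (TensorProduct.assoc R M.carrier C C (s ⊗ₜ c)) =
      pair κ b c • alphaRight κ M.carrier s a := by
    intro s c
    induction s with
    | zero => simp
    | tmul x d => simp [T, smul_smul, mul_comm]
    | add x y hx hy => simp only [TensorProduct.add_tmul, map_add, LinearMap.add_apply, hx, hy,
        smul_add]
  have h3 : ∀ t : M.carrier ⊗[R] C,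
      T (TensorProduct.assoc R M.carrier C C (M.coact.rTensor C t)) =
      alphaRight κ M.carrier (M.coact (alphaRight κ M.carrier t b)) a := by
    intro t
    induction t with
    | zero => simp
    | tmul x c => simp [h2]
    | add x y hx hy => simp only [map_add, LinearMap.add_apply, hx, hy]
  rw [← h1, ← M.coassoc, h3]

theorem alphaLeft_mul (M : LeftComod.{u, v₂, w} R C) (a b : A) (m : M.carrier) :
    alphaLeft κ M.carrier (M.coact m) (a * b) =
      alphaLeft κ M.carrier (M.coact (alphaLeft κ M.carrier (M.coact m) a)) b := by
  let T : (C ⊗[R] C) ⊗[R] M.carrier →ₗ[R] M.carrier :=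
    (TensorProduct.lid R M.carrier).toLinearMap ∘ₗ
      (LinearMap.mul' R R ∘ₗ TensorProduct.map (pair κ a) (pair κ b)).rTensor M.carrier
  have h1 : ∀ t : C ⊗[R] M.carrier, T ((Coalgebra.comul (R := R) (A := C)).rTensor M.carrier t) =
      alphaLeft κ M.carrier t (a * b) := by
    intro t
    induction t with
    | zero => simp
    | tmul c x => simp [T, pair_mul]
    | add x y hx hy => simp only [map_add, LinearMap.add_apply, hx, hy]
  have h2 : ∀ (s : C ⊗[R] M.carrier) (c : C),
      T ((TensorProduct.assoc R C C M.carrier).symm (c ⊗ₜ s)) =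
      pair κ a c • alphaLeft κ M.carrier s b := by
    intro s c
    induction s with
    | zero => simp
    | tmul d x => simp [T, smul_smul]
    | add x y hx hy => simp only [TensorProduct.tmul_add, map_add, LinearMap.add_apply, hx, hy,
        smul_add]
  have h3 : ∀ t : C ⊗[R] M.carrier,
      T ((TensorProduct.assoc R C C M.carrier).symm (M.coact.lTensor C t)) =
      alphaLeft κ M.carrier (M.coact (alphaLeft κ M.carrier t a)) b := by
    intro t
    induction t with
    | zero => simp
    | tmul c x => simp [h2]
    | add x y hx hy => simp only [map_add, LinearMap.add_apply, hx, hy]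
  rw [← h1, ← h3, ← M.coassoc, LinearEquiv.symm_apply_apply]

/-- The functor sending `(M, ϱ)` to the left `A`-module with `ρ = α_M ∘ ϱ`, that is
`a m = ∑ m₀ ⟨a, m₁⟩`; it is the identity on underlying maps. -/
def toLeftMod : RightComod.{u, v₂, w} R C ⥤ LeftMod.{u, v₁, w} R A where
  obj M :=
    { carrier := M.carrier
      act := (alphaRight κ M.carrier ∘ₗ M.coact).flip
      mul_act := fun a b m => alphaRight_mul κ M a b m }
  map {M N} f := ⟨f.toLin, fun a m => by
    simp only [LinearMap.flip_apply, LinearMap.comp_apply, f.map_coact, alphaRight_map]⟩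

/-- The functor sending `(M, ϱ)` to the right `A`-module with `m a = ∑ ⟨a, m₋₁⟩ m₀`; it is the
identity on underlying maps. -/
def toRightMod : LeftComod.{u, v₂, w} R C ⥤ RightMod.{u, v₁, w} R A where
  obj M :=
    { carrier := M.carrier
      act := (alphaLeft κ M.carrier ∘ₗ M.coact).flip
      act_mul := fun a b m => alphaLeft_mul κ M a b m }
  map {M N} f := ⟨f.toLin, fun a m => by
    simp only [LinearMap.flip_apply, LinearMap.comp_apply, f.map_coact, alphaLeft_map]⟩

/-- `C` as a left `A`-module: `a ⇀ c = ∑ c₁ ⟨a, c₂⟩`. -/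
def leftC : LeftMod.{u, v₁, v₂} R A := (toLeftMod κ).obj (RightComod.regular R C)

/-- `C` as a right `A`-module: `c ↼ a = ∑ ⟨a, c₁⟩ c₂`. -/
def rightC : RightMod.{u, v₁, v₂} R A := (toRightMod κ).obj (LeftComod.regular R C)

/-- `Rat^C(M) = ρ⁻¹(M ⊗ C)`, where `M ⊗ C` is mapped to `Hom_R(A, M)` by `α_M`. -/
def ratLeft (M : LeftMod.{u, v₁, w} R A) : Submodule R M.carrier :=
  (LinearMap.range (alphaRight κ M.carrier)).comap M.rho

/-- The rational part of a right `A`-module. -/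
def ratRight (M : RightMod.{u, v₁, w} R A) : Submodule R M.carrier :=
  (LinearMap.range (alphaLeft κ M.carrier)).comap M.rho

/-- The full subcategory of `A`-faithful `C`-rational left `A`-modules. -/
def ratFaithfulLeft : ObjectProperty (LeftMod.{u, v₁, w} R A) :=
  fun M => M.IsAFaithful ∧ ratLeft κ M = ⊤

/-- The full subcategory of unital `C`-rational left `A`-modules. -/
def ratUnitalLeft : ObjectProperty (LeftMod.{u, v₁, w} R A) :=
  fun M => M.IsUnital ∧ ratLeft κ M = ⊤

/-- The full subcategory of `A`-faithful `C`-rational right `A`-modules. -/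
def ratFaithfulRight : ObjectProperty (RightMod.{u, v₁, w} R A) :=
  fun M => M.IsAFaithful ∧ ratRight κ M = ⊤

/-- The full subcategory of unital `C`-rational right `A`-modules. -/
def ratUnitalRight : ObjectProperty (RightMod.{u, v₁, w} R A) :=
  fun M => M.IsUnital ∧ ratRight κ M = ⊤

/-- The measuring pairing `(C*, C)`. -/
def dualPairing (R : Type u) (C : Type v₂) [CommRing R] [AddCommGroup C] [Module R C]
    [Coalgebra R C] : ConvDual R C →ₙₐ[R] ConvDual R C := NonUnitalAlgHom.id R (ConvDual R C)

end Pairings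

end MeasuringPairing

end

open MeasuringPairing

noncomputable section

namespace MeasuringPairing

/-! ### Strict isomorphisms of categories -/

section Categories

/-! Two consequences of the hypotheses carry everything.

First, local projectivity gives, for finitely many elements of `C`, functionals `h_d` with `c = ∑
h_d(c) d` on these elements, and density replaces each `h_d` by some `a_d` in `A`. Hence every `t`
in `M ⊗ C` satisfies `t = ∑ α(t)(a_d) ⊗ d` (`exists_eq_sum_alphaRight`). So `α` is injective, and a
map `A → M` that becomes rational after an embedding `M → N` was already rational. A rational module
therefore has a unique candidate coaction, `α⁻¹ ∘ ρ`. After applying `α` twice, coassociativity is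
associativity of the action, colinearity is `A`-linearity, and injectivity of the coaction is
`A`-faithfulness.

Second, density gives elements `e` of `A` that agree with the counit on a prescribed finite set; by
the counit law they act as units in the pairing with a given `c` (`exists_finset_pair_mul`). On a
rational module, faithfulness or unitality each forces every `m` to be fixed by all `e` close enough
to the counit, and this local unitality gives back both. It also passes to sums, quotients and
submodules, as does rationality, so all of `σ[C]` is rational and unital. Conversely, the coaction
embeds `M` into `M ⊗ C`, a quotient of a direct sum of copies of `C`.

Since `C*` is dense in itself, the same applies to `(C*, C)`. Restriction along `κ` carries the
`C*`-module of a comodule to its `A`-module, so it is an isomorphism as well. -/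

/-- Bijectivity on objects, instead of essential surjectivity, makes the inverse strict: morphisms
are pulled back after conjugation by `eqToHom`. -/
theorem IsCategoryIso.of_fullyFaithful {𝒞 : Type*} {𝒟 : Type*} [Category 𝒞] [Category 𝒟]
    (F : 𝒞 ⥤ 𝒟) [F.Full] [F.Faithful] (hF : Function.Bijective F.obj) : IsCategoryIso F := by
  let e := Equiv.ofBijective F.obj hF
  have he : ∀ d, F.obj (e.symm d) = d := e.apply_symm_apply
  have he' : ∀ c, e.symm (F.obj c) = c := e.symm_apply_apply
  let G : 𝒟 ⥤ 𝒞 :=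
    { obj := e.symm
      map := fun {d d'} f => F.preimage (eqToHom (he d) ≫ f ≫ eqToHom (he d').symm)
      map_id := fun d => F.map_injective (by simp)
      map_comp := fun f g => F.map_injective (by simp) }
  refine ⟨G, CategoryTheory.Functor.ext he' fun c c' f => F.map_injective ?_, CategoryTheory.Functor.ext he fun d d' f => ?_⟩
  · simp [G, eqToHom_map]
  · simp [G]

end Categories

/-! ### The map `α` and approximate units -/

section Tensors

variable {R : Type u} {A : Type v₁} {C : Type v₂} [CommRing R] [NonUnitalRing A] [Module R A]
  [AddCommGroup C] [Module R C] [Coalgebra R C] (κ : A →ₙₐ[R] ConvDual R C)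

/-- A locally projective module has dual bases on finite subsets. -/
theorem IsLocallyProjective.exists_dualBasis {W : Type v₂} [AddCommGroup W] [Module R W]
    (hW : IsLocallyProjective R W) (S : Finset W) :
    ∃ h : W →ₗ[R] W →₀ R, ∀ x ∈ S, Finsupp.linearCombination R id (h x) = x := by
  -- The identity of `W` is lifted locally along the free cover `W →₀ R → W`; `ULift` puts the
  -- target in the universe over which local projectivity quantifies.
  obtain ⟨h, hh⟩ := hW (W →₀ R) (ULift.{u} W)
    (ULift.moduleEquiv.symm.toLinearMap ∘ₗ Finsupp.linearCombination R id)
    ULift.moduleEquiv.symm.toLinearMap (Submodule.span R (S : Set W))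
    (ULift.moduleEquiv.symm.surjective.comp (Finsupp.linearCombination_id_surjective R W))
    ⟨S, rfl⟩
  exact ⟨h, fun x hx => ULift.moduleEquiv.symm.injective (hh x (Submodule.subset_span hx))⟩

variable {κ}

/-- The functionals agreeing with `f` on `S` form an open set of the finite topology, nonempty
because it contains `f`. -/
theorem HasDenseRange.exists_pair_eq (hκ : HasDenseRange κ) (f : C →ₗ[R] R) (S : Finset C) :
    ∃ a, ∀ c ∈ S, pair κ a c = f c := by
  let _ : TopologicalSpace R := ⊥
  have _ : DiscreteTopology R := ⟨rfl⟩
  let _ := finiteTopology R C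
  obtain ⟨_, hg, a, rfl⟩ := hκ.inter_open_nonempty
    {g : ConvDual R C | ∀ c ∈ S, g.ofConv c = f c}
    (isOpen_induced_iff.2 ⟨(S : Set C).pi fun c => {f c},
      isOpen_set_pi S.finite_toSet fun _ _ => isOpen_discrete _, by ext; simp [Set.mem_pi]⟩)
    ⟨WithConv.toConv f, fun _ _ => rfl⟩
  exact ⟨a, hg⟩

theorem hasDenseRange_dualPairing : HasDenseRange (dualPairing R C) := by
  let _ := finiteTopology R C
  have h : Set.range (dualPairing R C) = Set.univ := Set.range_id
  unfold HasDenseRange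
  rw [h]
  exact dense_univ

/-- Elements of `M ⊗ C` are recovered from their images under `α_M`. -/
theorem exists_eq_sum_alphaRight (hC : IsLocallyProjective R C) (hκ : HasDenseRange κ)
    {M : Type w} [AddCommGroup M] [Module R M] (t : M ⊗[R] C) :
    ∃ (s : Finset C) (a : C → A), t = ∑ d ∈ s, alphaRight κ M t (a d) ⊗ₜ[R] d := by
  classical
  obtain ⟨T, rfl⟩ := TensorProduct.exists_finset t
  obtain ⟨h, hh⟩ := hC.exists_dualBasis (T.image Prod.snd)
  -- `a d` imitates the `d`-th coordinate of `h` on the finitely many elements of `C` occurring in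
  -- `t`.
  choose a ha using fun d => hκ.exists_pair_eq (Finsupp.lapply d ∘ₗ h) (T.image Prod.snd)
  refine ⟨T.biUnion fun i => (h i.2).support, a, ?_⟩
  simp only [map_sum, LinearMap.sum_apply, alphaRight_tmul, TensorProduct.sum_tmul]
  rw [Finset.sum_comm]
  refine Finset.sum_congr rfl fun i hi => ?_
  have hi' : i.2 ∈ T.image Prod.snd := Finset.mem_image_of_mem _ hi
  conv_lhs => rw [← hh _ hi', Finsupp.linearCombination_apply, Finsupp.sum,
    TensorProduct.tmul_sum]
  -- For a fixed pure tensor, the indices outside the support of `h i.2` contribute zero.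
  rw [← Finset.sum_subset (Finset.subset_biUnion_of_mem (fun i : M × C => (h i.2).support) hi)]
  · refine Finset.sum_congr rfl fun d _ => ?_
    rw [ha d _ hi', TensorProduct.smul_tmul]
    rfl
  · intro d _ hd
    rw [ha d _ hi', LinearMap.comp_apply, Finsupp.lapply_apply, Finsupp.notMem_support_iff.1 hd,
      zero_smul, TensorProduct.zero_tmul]

theorem alphaRight_injective (hC : IsLocallyProjective R C) (hκ : HasDenseRange κ)
    (M : Type w) [AddCommGroup M] [Module R M] : Function.Injective (alphaRight κ M) := by
  rw [injective_iff_map_eq_zero]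
  intro t ht
  obtain ⟨s, a, h⟩ := exists_eq_sum_alphaRight hC hκ t
  rw [h, ht]
  simp

theorem alphaLeft_injective (hC : IsLocallyProjective R C) (hκ : HasDenseRange κ)
    (M : Type w) [AddCommGroup M] [Module R M] : Function.Injective (alphaLeft κ M) :=
  (alphaRight_injective hC hκ M).comp (TensorProduct.comm R C M).injective

variable (κ)

/-- Naturality of `α` is needed across universes, for instance for a coaction `M → M ⊗ C` or an
embedding into a larger subgenerated module. -/
theorem alphaRight_rTensor {M : Type w₁} [AddCommGroup M] [Module R M] {N : Type w₂}
    [AddCommGroup N] [Module R N] (f : M →ₗ[R] N) (t : M ⊗[R] C) (a : A) :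
    alphaRight κ N (f.rTensor C t) a = f (alphaRight κ M t a) := by
  induction t with
  | zero => simp
  | tmul x c => simp
  | add x y hx hy => simp only [map_add, LinearMap.add_apply, hx, hy]

theorem alphaLeft_lTensor {M : Type w₁} [AddCommGroup M] [Module R M] {N : Type w₂}
    [AddCommGroup N] [Module R N] (f : M →ₗ[R] N) (t : C ⊗[R] M) (a : A) :
    alphaLeft κ N (f.lTensor C t) a = f (alphaLeft κ M t a) := by
  induction t with
  | zero => simp
  | tmul c x => simp
  | add x y hx hy => simp only [map_add, LinearMap.add_apply, hx, hy]

/-- If `α_N(t)` takes values in the image of `i : M → N`, then it lies in the image of `α_M`. -/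
theorem mem_range_alphaRight_of_injective (hC : IsLocallyProjective R C) (hκ : HasDenseRange κ)
    {M : Type w₁} [AddCommGroup M] [Module R M] {N : Type w₂} [AddCommGroup N] [Module R N]
    {i : M →ₗ[R] N} (hi : Function.Injective i) {g : A →ₗ[R] M}
    (h : i ∘ₗ g ∈ LinearMap.range (alphaRight κ N)) : g ∈ LinearMap.range (alphaRight κ M) := by
  obtain ⟨t, ht⟩ := h
  obtain ⟨s, a, hs⟩ := exists_eq_sum_alphaRight hC hκ t
  -- In the recovery formula for `t` the coefficients are `i (g (a d))`; removing `i` gives the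
  -- preimage.
  refine ⟨∑ d ∈ s, g (a d) ⊗ₜ[R] d, LinearMap.ext fun b => hi ?_⟩
  rw [← alphaRight_rTensor, map_sum]
  change _ = (i ∘ₗ g) b
  rw [← ht]
  conv_rhs => rw [hs, ht]
  rfl

theorem alphaRight_dualPairing {M : Type w} [AddCommGroup M] [Module R M] (t : M ⊗[R] C) (a : A) :
    alphaRight (dualPairing R C) M t (κ a) = alphaRight κ M t a := by
  induction t with
  | zero => simp
  | tmul x c => rfl
  | add x y hx hy => simp only [map_add, LinearMap.add_apply, hx, hy]

theorem alphaLeft_dualPairing {M : Type w} [AddCommGroup M] [Module R M] (t : C ⊗[R] M) (a : A) :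
    alphaLeft (dualPairing R C) M t (κ a) = alphaLeft κ M t a :=
  alphaRight_dualPairing κ _ a

/-- This lets the descent of rationality along embeddings serve right modules too. -/
theorem range_alphaLeft (M : Type w) [AddCommGroup M] [Module R M] :
    LinearMap.range (alphaLeft κ M) = LinearMap.range (alphaRight κ M) :=
  LinearMap.range_comp_of_range_eq_top _ (LinearEquiv.range _)

/-- If `κ(e)` agrees with `ε` on the tensor legs of `Δ(c)`, then `∑ ⟨b, c₁⟩⟨e, c₂⟩ = ∑ ⟨b, c₁⟩ ε(c₂)
= ⟨b, c⟩`, and symmetrically. That `S` does not depend on `b` is essential for cancelling `b` by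
faithfulness. -/
theorem exists_finset_pair_mul (c : C) : ∃ S : Finset C, ∀ e : A,
    (∀ d ∈ S, pair κ e d = Coalgebra.counit (R := R) d) →
      ∀ b, pair κ (b * e) c = pair κ b c ∧ pair κ (e * b) c = pair κ b c := by
  classical
  obtain ⟨T, hT⟩ := TensorProduct.exists_finset (Coalgebra.comul (R := R) c)
  refine ⟨T.image Prod.fst ∪ T.image Prod.snd, fun e he b => ?_⟩
  have h₁ : ∀ i ∈ T, pair κ e i.1 = Coalgebra.counit (R := R) i.1 := fun i hi =>
    he _ (Finset.mem_union_left _ (Finset.mem_image_of_mem _ hi))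
  have h₂ : ∀ i ∈ T, pair κ e i.2 = Coalgebra.counit (R := R) i.2 := fun i hi =>
    he _ (Finset.mem_union_right _ (Finset.mem_image_of_mem _ hi))
  have k₁ : ∑ i ∈ T, Coalgebra.counit (R := R) i.1 • i.2 = c := by
    have := congrArg (TensorProduct.lid R C) (Coalgebra.rTensor_counit_comul (R := R) c)
    simpa [hT] using this
  have k₂ : ∑ i ∈ T, Coalgebra.counit (R := R) i.2 • i.1 = c := by
    have := congrArg (TensorProduct.rid R C) (Coalgebra.lTensor_counit_comul (R := R) c)
    simpa [hT] using this
  constructor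
  · rw [pair_mul, hT]
    conv_rhs => rw [← k₂]
    simp only [map_sum, TensorProduct.map_tmul, LinearMap.mul'_apply, map_smul, smul_eq_mul]
    exact Finset.sum_congr rfl fun i hi => by rw [h₂ i hi, mul_comm]
  · rw [pair_mul, hT]
    conv_rhs => rw [← k₁]
    simp only [map_sum, TensorProduct.map_tmul, LinearMap.mul'_apply, map_smul, smul_eq_mul]
    exact Finset.sum_congr rfl fun i hi => by rw [h₁ i hi]

theorem exists_finset_alphaRight_mul {M : Type w} [AddCommGroup M] [Module R M] (t : M ⊗[R] C) :
    ∃ S : Finset C, ∀ e : A, (∀ d ∈ S, pair κ e d = Coalgebra.counit (R := R) d) →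
      ∀ b, alphaRight κ M t (b * e) = alphaRight κ M t b ∧
        alphaRight κ M t (e * b) = alphaRight κ M t b := by
  classical
  induction t with
  | zero => exact ⟨∅, by simp⟩
  | tmul m c =>
    obtain ⟨S, hS⟩ := exists_finset_pair_mul κ c
    exact ⟨S, fun e he b => by simp [hS e he b]⟩
  | add x y hx hy =>
    obtain ⟨S, hS⟩ := hx
    obtain ⟨T, hT⟩ := hy
    refine ⟨S ∪ T, fun e he b => ?_⟩
    have h₁ := hS e (fun d hd => he d (Finset.mem_union_left _ hd)) b
    have h₂ := hT e (fun d hd => he d (Finset.mem_union_right _ hd)) b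
    simp [h₁, h₂]

end Tensors

/-! ### Right comodules and rational left modules -/

section LeftModules

variable {R : Type u} {A : Type v₁} {C : Type v₂} [CommRing R] [NonUnitalRing A] [Module R A]
  [AddCommGroup C] [Module R C] [Coalgebra R C] (κ : A →ₙₐ[R] ConvDual R C)

/-- The elements of a left module fixed by all `a` such that `κ(a)` is close to the counit. -/
def locallyUnitalLeft (M : LeftMod.{u, v₁, w} R A) : Submodule R M.carrier where
  carrier := {m | ∃ S : Finset C, ∀ e : A, (∀ d ∈ S, pair κ e d = Coalgebra.counit (R := R) d) →
    M.act e m = m}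
  zero_mem' := ⟨∅, by simp⟩
  add_mem' := by
    classical
    rintro x y ⟨S, hS⟩ ⟨T, hT⟩
    refine ⟨S ∪ T, fun e he => ?_⟩
    rw [map_add, hS e fun d hd => he d (Finset.mem_union_left _ hd),
      hT e fun d hd => he d (Finset.mem_union_right _ hd)]
  smul_mem' := by
    rintro r x ⟨S, hS⟩
    exact ⟨S, fun e he => by rw [map_smul, hS e he]⟩

variable {κ}

/-- For all `b`, `b(em) = (be)m = bm` once `κ(e)` is close to the counit; faithfulness cancels `b`.
-/
theorem locallyUnitalLeft_eq_top_of_faithful {M : LeftMod.{u, v₁, w} R A}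
    (h : ratFaithfulLeft κ M) : locallyUnitalLeft κ M = ⊤ := by
  refine eq_top_iff.2 fun m _ => ?_
  obtain ⟨t, ht⟩ : m ∈ ratLeft κ M := h.2 ▸ Submodule.mem_top
  obtain ⟨S, hS⟩ := exists_finset_alphaRight_mul κ t
  refine ⟨S, fun e he => h.1 (LinearMap.ext fun b => ?_)⟩
  have := (hS e he b).1
  rw [ht] at this
  exact (M.mul_act b e m).symm.trans this

/-- On the generators `am` of `M = AM`, `e(am) = (ea)m = am` for `κ(e)` close to the counit. -/
theorem locallyUnitalLeft_eq_top_of_unital {M : LeftMod.{u, v₁, w} R A}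
    (h : ratUnitalLeft κ M) : locallyUnitalLeft κ M = ⊤ := by
  refine eq_top_iff.2 (le_of_eq_of_le h.1.symm (Submodule.span_le.2 ?_))
  rintro _ ⟨a, m, rfl⟩
  obtain ⟨t, ht⟩ : m ∈ ratLeft κ M := h.2 ▸ Submodule.mem_top
  obtain ⟨S, hS⟩ := exists_finset_alphaRight_mul κ t
  refine ⟨S, fun e he => ?_⟩
  have := (hS e he a).2
  rw [ht] at this
  exact (M.mul_act e a m).symm.trans this

/-- Density provides some `e` with `em = m`, so an `m` killed by all of `A` is zero. -/
theorem LeftMod.isAFaithful_of_locallyUnital (hκ : HasDenseRange κ) {M : LeftMod.{u, v₁, w} R A}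
    (h : locallyUnitalLeft κ M = ⊤) : M.IsAFaithful := by
  refine (injective_iff_map_eq_zero M.rho).2 fun m hm => ?_
  obtain ⟨S, hS⟩ : m ∈ locallyUnitalLeft κ M := h ▸ Submodule.mem_top
  obtain ⟨e, he⟩ := hκ.exists_pair_eq Coalgebra.counit S
  rw [← hS e he]
  exact LinearMap.congr_fun hm e

theorem LeftMod.isUnital_of_locallyUnital (hκ : HasDenseRange κ) {M : LeftMod.{u, v₁, w} R A}
    (h : locallyUnitalLeft κ M = ⊤) : M.IsUnital := by
  refine eq_top_iff.2 fun m _ => ?_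
  obtain ⟨S, hS⟩ : m ∈ locallyUnitalLeft κ M := h ▸ Submodule.mem_top
  obtain ⟨e, he⟩ := hκ.exists_pair_eq Coalgebra.counit S
  exact Submodule.subset_span ⟨e, m, hS e he⟩

theorem ratFaithfulLeft_eq_ratUnitalLeft (hκ : HasDenseRange κ) :
    ratFaithfulLeft.{u, v₁, v₂, w} κ = ratUnitalLeft κ := by
  funext M
  exact propext
    ⟨fun h => ⟨M.isUnital_of_locallyUnital hκ (locallyUnitalLeft_eq_top_of_faithful h), h.2⟩,
    fun h => ⟨M.isAFaithful_of_locallyUnital hκ (locallyUnitalLeft_eq_top_of_unital h), h.2⟩⟩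

/-! Comodules as modules -/

theorem ratFaithfulLeft_toLeftMod (hC : IsLocallyProjective R C) (hκ : HasDenseRange κ)
    (M : RightComod.{u, v₂, w} R C) : ratFaithfulLeft κ ((toLeftMod κ).obj M) :=
  ⟨(alphaRight_injective hC hκ M.carrier).comp M.injective_coact,
    eq_top_iff.2 fun m _ => ⟨M.coact m, rfl⟩⟩

/-- Strict isomorphisms need equalities of objects; on a fixed carrier these reduce to equality of
actions. -/
theorem LeftMod.mk_act_eq (M : LeftMod.{u, v₁, w} R A) (act : A →ₗ[R] M.carrier →ₗ[R] M.carrier)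
    (hmul) (h : act = M.act) : ({ carrier := M.carrier, act := act, mul_act := hmul } :
      LeftMod.{u, v₁, w} R A) = M := by
  subst h
  rfl

theorem toLeftMod_obj_injective (hC : IsLocallyProjective R C) (hκ : HasDenseRange κ) :
    Function.Injective (toLeftMod.{u, v₁, v₂, w} κ).obj := by
  rintro ⟨M, ϱ, h₁, h₂⟩ ⟨N, ϱ', h₃, h₄⟩ h
  injection h with hM h h' hact
  subst hM
  obtain rfl := eq_of_heq h
  obtain rfl := eq_of_heq h'
  have : ϱ = ϱ' := LinearMap.ext fun m => alphaRight_injective hC hκ M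
    (LinearMap.ext fun a => LinearMap.congr_fun (LinearMap.congr_fun (eq_of_heq hact) a) m)
  subst this
  rfl

/-- Rationality lets `ρ` factor through the injective `α`, and the factor is the coaction;
faithfulness makes it injective. -/
theorem toLeftMod_obj_surjective (hC : IsLocallyProjective R C) (hκ : HasDenseRange κ)
    {M : LeftMod.{u, v₁, w} R A} (h : ratFaithfulLeft κ M) :
    ∃ N, (toLeftMod κ).obj N = M := by
  have hα := alphaRight_injective hC hκ M.carrier
  let ϱ : M.carrier →ₗ[R] M.carrier ⊗[R] C :=
    (LinearEquiv.ofInjective _ hα).symm.toLinearMap ∘ₗ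
      M.rho.codRestrict _ fun m => (h.2 ▸ Submodule.mem_top : m ∈ ratLeft κ M)
  have hϱ : ∀ m a, alphaRight κ M.carrier (ϱ m) a = M.act a m := fun m a => by
    have := congrArg Subtype.val ((LinearEquiv.ofInjective _ hα).apply_symm_apply
      (M.rho.codRestrict _ (fun m => (h.2 ▸ Submodule.mem_top : m ∈ ratLeft κ M)) m))
    exact LinearMap.congr_fun this a
  have h₁ : ∀ (t : M.carrier ⊗[R] C) (a b : A), alphaRight κ M.carrier (alphaRight κ _
      ((TensorProduct.assoc R M.carrier C C).symm
        ((Coalgebra.comul (R := R) (A := C)).lTensor M.carrier t)) b) a =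
      alphaRight κ M.carrier t (a * b) := by
    intro t a b
    induction t with
    | zero => simp
    | tmul x c =>
      rw [LinearMap.lTensor_tmul, alphaRight_tmul, pair_mul]
      induction Coalgebra.comul (R := R) c with
      | zero => simp
      | tmul y z => simp [smul_smul, mul_comm]
      | add y z hy hz => simp only [TensorProduct.tmul_add, map_add, LinearMap.add_apply, hy, hz,
          add_smul]
    | add x y hx hy => simp only [map_add, LinearMap.add_apply, hx, hy]
  refine ⟨⟨M.carrier, ϱ, fun m => ?_, fun m n hmn => h.1 (LinearMap.ext fun a => ?_)⟩,
    M.mk_act_eq _ _ (LinearMap.ext fun a => LinearMap.ext fun m => hϱ m a)⟩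
  -- Evaluating `α` on `M ⊗ C` at `b` and then `α` on `M` at `a` turns the two sides of
  -- coassociativity into `a(bm)` and `(ab)m`.
  · apply (TensorProduct.assoc R M.carrier C C).symm.injective
    rw [LinearEquiv.symm_apply_apply]
    refine alphaRight_injective hC hκ _ (LinearMap.ext fun b => hα (LinearMap.ext fun a => ?_))
    rw [h₁, alphaRight_rTensor, hϱ, hϱ, hϱ, M.mul_act]
  · exact (hϱ m a).symm.trans ((congrArg (alphaRight κ M.carrier · a) hmn).trans (hϱ n a))

theorem toLeftMod_full (hC : IsLocallyProjective R C) (hκ : HasDenseRange κ) :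
    (toLeftMod.{u, v₁, v₂, w} κ).Full where
  map_surjective {M N} f := ⟨⟨f.toLin, fun m => alphaRight_injective hC hκ N.carrier
    (LinearMap.ext fun a => (f.map_act a m).symm.trans
      (alphaRight_rTensor κ (M := M.carrier) (N := N.carrier) f.toLin (M.coact m) a).symm)⟩, rfl⟩

instance toLeftMod_faithful : (toLeftMod.{u, v₁, v₂, w} κ).Faithful where
  map_injective h := RightComod.Hom.ext (congrArg LeftMod.Hom.toLin h)

theorem isCategoryIso_toLeftMod (hC : IsLocallyProjective R C) (hκ : HasDenseRange κ)
    (h : ∀ M : RightComod.{u, v₂, w} R C, ratFaithfulLeft κ ((toLeftMod κ).obj M)) :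
    IsCategoryIso ((ratFaithfulLeft κ).lift (toLeftMod κ) h) := by
  have := toLeftMod_full.{u, v₁, v₂, w} hC hκ
  refine IsCategoryIso.of_fullyFaithful _ ⟨fun M N hMN => ?_, fun M => ?_⟩
  · exact toLeftMod_obj_injective hC hκ (congrArg ObjectProperty.FullSubcategory.obj hMN)
  · obtain ⟨N, hN⟩ := toLeftMod_obj_surjective hC hκ M.property
    exact ⟨N, ObjectProperty.FullSubcategory.ext hN⟩

theorem restrict_toLeftMod_obj (M : RightComod.{u, v₂, w} R C) :
    (LeftMod.restrict κ).obj ((toLeftMod (dualPairing R C)).obj M) = (toLeftMod κ).obj M :=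
  LeftMod.mk_act_eq ((toLeftMod κ).obj M) _ _
    (LinearMap.ext fun a => LinearMap.ext fun m => alphaRight_dualPairing κ (M.coact m) a)

/-- Faithfulness over `C*` does not formally give faithfulness over `A`; the underlying comodule
supplies it. -/
theorem ratFaithfulLeft_restrict (hC : IsLocallyProjective R C) (hκ : HasDenseRange κ)
    (M : (ratFaithfulLeft.{u, max u v₂, v₂, w} (dualPairing R C)).FullSubcategory) :
    ratFaithfulLeft κ
      (((ratFaithfulLeft (dualPairing R C)).ι ⋙ LeftMod.restrict κ).obj M) := by
  obtain ⟨M, hM⟩ := M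
  obtain ⟨N, rfl⟩ := toLeftMod_obj_surjective hC hasDenseRange_dualPairing hM
  have := ratFaithfulLeft_toLeftMod hC hκ N
  rwa [← restrict_toLeftMod_obj] at this

/-- Objects on both sides come from comodules, and restriction fixes the comodule, so everything is
compared there. -/
theorem isCategoryIso_restrictLeft (hC : IsLocallyProjective R C) (hκ : HasDenseRange κ)
    (h : ∀ M : (ratFaithfulLeft.{u, max u v₂, v₂, w} (dualPairing R C)).FullSubcategory,
      ratFaithfulLeft κ
        (((ratFaithfulLeft (dualPairing R C)).ι ⋙ LeftMod.restrict κ).obj M)) :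
    IsCategoryIso ((ratFaithfulLeft κ).lift
      ((ratFaithfulLeft (dualPairing R C)).ι ⋙ LeftMod.restrict κ) h) := by
  have hobj {M : LeftMod.{u, max u v₂, w} R (ConvDual R C)}
      (hM : ratFaithfulLeft (dualPairing R C) M) :=
    toLeftMod_obj_surjective hC hasDenseRange_dualPairing hM
  let F := (ratFaithfulLeft κ).lift
    ((ratFaithfulLeft (dualPairing R C)).ι ⋙ LeftMod.restrict κ) h
  have : F.Faithful :=
    ⟨fun {M N f g} hfg => ObjectProperty.hom_ext _ (LeftMod.Hom.ext
      (congrArg (fun k => LeftMod.Hom.toLin (InducedCategory.Hom.hom k)) hfg))⟩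
  have : F.Full := by
    refine ⟨?_⟩
    rintro ⟨M, hM⟩ ⟨N, hN⟩ f
    obtain ⟨M, rfl⟩ := hobj hM
    obtain ⟨N, rfl⟩ := hobj hN
    -- An `A`-linear map is colinear because `α` over `A` is injective, and a colinear map is
    -- `C*`-linear.
    let g : M ⟶ N := ⟨f.hom.toLin, fun m => alphaRight_injective hC hκ N.carrier
      (LinearMap.ext fun a => (alphaRight_dualPairing κ (N.coact (f.hom.toLin m)) a).symm.trans
        ((f.hom.map_act a m).symm.trans ((congrArg f.hom.toLin
          (alphaRight_dualPairing κ (M.coact m) a)).trans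
          (alphaRight_rTensor κ (M := M.carrier) (N := N.carrier) f.hom.toLin
            (M.coact m) a).symm)))⟩
    exact ⟨ObjectProperty.homMk ((toLeftMod (dualPairing R C)).map g), rfl⟩
  refine IsCategoryIso.of_fullyFaithful F ⟨?_, ?_⟩
  · rintro ⟨M, hM⟩ ⟨N, hN⟩ hMN
    obtain ⟨M, rfl⟩ := hobj hM
    obtain ⟨N, rfl⟩ := hobj hN
    have hMN' := congrArg ObjectProperty.FullSubcategory.obj hMN
    obtain rfl : M = N := toLeftMod_obj_injective hC hκ
      ((restrict_toLeftMod_obj M).symm.trans (hMN'.trans (restrict_toLeftMod_obj N)))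
    rfl
  · rintro ⟨M, hM⟩
    obtain ⟨M, rfl⟩ := toLeftMod_obj_surjective hC hκ hM
    exact ⟨⟨_, ratFaithfulLeft_toLeftMod hC hasDenseRange_dualPairing M⟩,
      ObjectProperty.FullSubcategory.ext (restrict_toLeftMod_obj M)⟩

/-! Subgenerated modules -/

/-- Faithfulness is in general lost in quotients and unitality in submodules; local unitality
survives both, hence its use for `σ[C]`. -/
theorem LeftMod.Hom.map_mem_locallyUnital {M : LeftMod.{u, v₁, w₁} R A}
    {N : LeftMod.{u, v₁, w₂} R A} (f : LeftMod.Hom M N) {m : M.carrier}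
    (hm : m ∈ locallyUnitalLeft κ M) : f.toLin m ∈ locallyUnitalLeft κ N := by
  obtain ⟨S, hS⟩ := hm
  exact ⟨S, fun e he => by rw [← f.map_act, hS e he]⟩

theorem LeftMod.Hom.mem_locallyUnital_of_injective {M : LeftMod.{u, v₁, w₁} R A}
    {N : LeftMod.{u, v₁, w₂} R A} (f : LeftMod.Hom M N) (hf : Function.Injective f.toLin)
    {m : M.carrier} (hm : f.toLin m ∈ locallyUnitalLeft κ N) : m ∈ locallyUnitalLeft κ M := by
  obtain ⟨S, hS⟩ := hm
  exact ⟨S, fun e he => hf (by rw [f.map_act, hS e he])⟩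

theorem LeftMod.Hom.map_mem_rat {M : LeftMod.{u, v₁, w₁} R A}
    {N : LeftMod.{u, v₁, w₂} R A} (f : LeftMod.Hom M N) {m : M.carrier}
    (hm : m ∈ ratLeft κ M) : f.toLin m ∈ ratLeft κ N := by
  obtain ⟨t, ht⟩ := hm
  refine ⟨f.toLin.rTensor C t, LinearMap.ext fun a => ?_⟩
  rw [alphaRight_rTensor, ht]
  exact f.map_act a m

theorem LeftMod.Hom.mem_rat_of_injective (hC : IsLocallyProjective R C) (hκ : HasDenseRange κ)
    {M : LeftMod.{u, v₁, w₁} R A} {N : LeftMod.{u, v₁, w₂} R A} (f : LeftMod.Hom M N)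
    (hf : Function.Injective f.toLin) {m : M.carrier} (hm : f.toLin m ∈ ratLeft κ N) :
    m ∈ ratLeft κ M := by
  have : f.toLin ∘ₗ M.rho m = N.rho (f.toLin m) := LinearMap.ext fun a => f.map_act a m
  exact mem_range_alphaRight_of_injective κ hC hκ hf (this ▸ hm)

/-- The coprojections into a direct sum of copies of `K`. -/
def LeftMod.copowerSingle {Λ : Type w₂} (K : LeftMod.{u, v₁, w₁} R A) (i : Λ) :
    LeftMod.Hom K (LeftMod.copower Λ K) :=
  ⟨Finsupp.lsingle i, fun a _ => (Finsupp.mapRange_single (hf := map_zero (K.act a))).symm⟩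

theorem LeftMod.copower_submodule_eq_top {Λ : Type w₂} {K : LeftMod.{u, v₁, w₁} R A}
    {P : Submodule R (LeftMod.copower Λ K).carrier}
    (h : ∀ i x, (LeftMod.copowerSingle K i).toLin x ∈ P) (x : (LeftMod.copower Λ K).carrier) :
    x ∈ P :=
  Finsupp.induction_linear x P.zero_mem (fun _ _ => P.add_mem) h

theorem ratUnitalLeft_of_sigma (hC : IsLocallyProjective R C) (hκ : HasDenseRange κ)
    {N : LeftMod.{u, v₁, w} R A} (h : LeftMod.sigma (leftC κ) N) : ratUnitalLeft κ N := by
  obtain ⟨Q, Λ, p, i, hp, hi⟩ := h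
  have hK : ratFaithfulLeft κ (leftC κ) := ratFaithfulLeft_toLeftMod hC hκ _
  have hK' := locallyUnitalLeft_eq_top_of_faithful hK
  have h₁ : ∀ q, q ∈ locallyUnitalLeft κ Q := fun q => by
    obtain ⟨x, rfl⟩ := hp q
    exact p.map_mem_locallyUnital (LeftMod.copower_submodule_eq_top
      (fun i x => LeftMod.Hom.map_mem_locallyUnital _ (hK' ▸ Submodule.mem_top)) x)
  have h₂ : ∀ q, q ∈ ratLeft κ Q := fun q => by
    obtain ⟨x, rfl⟩ := hp q
    exact p.map_mem_rat (LeftMod.copower_submodule_eq_top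
      (fun i x => LeftMod.Hom.map_mem_rat _ (hK.2 ▸ Submodule.mem_top)) x)
  exact ⟨N.isUnital_of_locallyUnital hκ
    (eq_top_iff.2 fun n _ => i.mem_locallyUnital_of_injective hi (h₁ _)),
    eq_top_iff.2 fun n _ => i.mem_rat_of_injective hC hκ hi (h₂ _)⟩

/-- `M ⊗ K` with the action on the second factor. -/
def LeftMod.tensor (M : Type w₁) [AddCommGroup M] [Module R M] (K : LeftMod.{u, v₁, w₂} R A) :
    LeftMod.{u, v₁, max w₁ w₂} R A where
  carrier := M ⊗[R] K.carrier
  act := LinearMap.lTensorHom M ∘ₗ K.act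
  mul_act a b t := by
    induction t with
    | zero => simp
    | tmul m x => simp [K.mul_act]
    | add x y hx hy => simp only [map_add, hx, hy]

/-- The reason is `∑ ⟨b, c₁⟩⟨a, c₂⟩ = ⟨ba, c⟩`; it is what makes the coaction `M → M ⊗ C` an
`A`-linear map. -/
theorem alphaRight_lTensor_flip (M : Type w) [AddCommGroup M] [Module R M] (t : M ⊗[R] C)
    (a b : A) : alphaRight κ M (((alphaRight κ C ∘ₗ Coalgebra.comul).flip a).lTensor M t) b =
      alphaRight κ M t (b * a) := by
  induction t with
  | zero => simp
  | tmul m c =>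
    rw [LinearMap.lTensor_tmul, LinearMap.flip_apply, LinearMap.comp_apply, alphaRight_tmul, alphaRight_tmul, pair_mul]
    congr 1
    induction Coalgebra.comul (R := R) c with
    | zero => simp
    | tmul y z => simp [mul_comm]
    | add y z hy hz => simp only [map_add, LinearMap.add_apply, hy, hz]
  | add x y hx hy => simp only [map_add, LinearMap.add_apply, hx, hy]

theorem sigma_of_ratFaithfulLeft (hC : IsLocallyProjective R C) (hκ : HasDenseRange κ)
    {N : LeftMod.{u, v₁, w} R A} (h : ratFaithfulLeft κ N) : LeftMod.sigma (leftC κ) N := by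
  obtain ⟨M, rfl⟩ := toLeftMod_obj_surjective hC hκ h
  -- One copy of `C` for each `m`, mapped by `c ↦ m ⊗ c`; `ULift` moves the index set to the
  -- universe required by `σ[C]`.
  let p : (ULift.{max v₂ w} M.carrier →₀ C) →ₗ[R] M.carrier ⊗[R] C :=
    Finsupp.lsum R fun m => TensorProduct.mk R M.carrier C m.down
  have hp : ∀ m c, p (Finsupp.single m c) = m.down ⊗ₜ[R] c := fun m c => by simp [p]
  have hp' : Function.Surjective p := fun t => by
    induction t with
    | zero => exact ⟨0, map_zero p⟩
    | tmul m c => exact ⟨_, hp ⟨m⟩ c⟩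
    | add x y hx hy =>
      obtain ⟨x, rfl⟩ := hx
      obtain ⟨y, rfl⟩ := hy
      exact ⟨x + y, map_add p x y⟩
  refine ⟨LeftMod.tensor M.carrier (leftC κ), ULift.{max v₂ w} M.carrier, ⟨p, fun a x => ?_⟩,
    ⟨M.coact, fun a m => ?_⟩, hp', M.injective_coact⟩
  · refine DFunLike.congr_fun (Finsupp.lhom_ext (φ := p ∘ₗ (LeftMod.copower _ (leftC κ)).act a)
      (ψ := (LeftMod.tensor M.carrier (leftC κ)).act a ∘ₗ p) fun m c => ?_) x
    have : (LeftMod.copower _ (leftC κ)).act a (Finsupp.single m c) =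
        Finsupp.single m ((leftC κ).act a c) :=
      Finsupp.mapRange_single (hf := map_zero ((leftC κ).act a))
    exact (congrArg p this).trans ((hp _ _).trans
      (congrArg ((LeftMod.tensor M.carrier (leftC κ)).act a) (hp m c)).symm)
  -- After `α`, linearity of the coaction reads `b(am) = (ba)m`.
  · refine alphaRight_injective hC hκ M.carrier (LinearMap.ext fun b => ?_)
    exact (((toLeftMod κ).obj M).mul_act b a m).symm.trans
      (alphaRight_lTensor_flip M.carrier (M.coact m) a b).symm

theorem ratUnitalLeft_eq_sigma (hC : IsLocallyProjective R C) (hκ : HasDenseRange κ) :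
    ratUnitalLeft.{u, v₁, v₂, w} κ = LeftMod.sigma (leftC κ) := by
  funext M
  refine propext ⟨fun h => sigma_of_ratFaithfulLeft hC hκ ?_, ratUnitalLeft_of_sigma hC hκ⟩
  rwa [ratFaithfulLeft_eq_ratUnitalLeft hκ]

end LeftModules

/-! ### Left comodules and rational right modules -/

section RightModules

variable {R : Type u} {A : Type v₁} {C : Type v₂} [CommRing R] [NonUnitalRing A] [Module R A]
  [AddCommGroup C] [Module R C] [Coalgebra R C] (κ : A →ₙₐ[R] ConvDual R C)

/-- The elements of a right module fixed by all `a` such that `κ(a)` is close to the counit. -/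
def locallyUnitalRight (M : RightMod.{u, v₁, w} R A) : Submodule R M.carrier where
  carrier := {m | ∃ S : Finset C, ∀ e : A, (∀ d ∈ S, pair κ e d = Coalgebra.counit (R := R) d) →
    M.act e m = m}
  zero_mem' := ⟨∅, by simp⟩
  add_mem' := by
    classical
    rintro x y ⟨S, hS⟩ ⟨T, hT⟩
    refine ⟨S ∪ T, fun e he => ?_⟩
    rw [map_add, hS e fun d hd => he d (Finset.mem_union_left _ hd),
      hT e fun d hd => he d (Finset.mem_union_right _ hd)]
  smul_mem' := by
    rintro r x ⟨S, hS⟩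
    exact ⟨S, fun e he => by rw [map_smul, hS e he]⟩

variable {κ}

/-- Here `(me)b = m(eb) = mb`, so the other half of the approximate unit property is used. -/
theorem locallyUnitalRight_eq_top_of_faithful {M : RightMod.{u, v₁, w} R A}
    (h : ratFaithfulRight κ M) : locallyUnitalRight κ M = ⊤ := by
  refine eq_top_iff.2 fun m _ => ?_
  obtain ⟨t, ht⟩ : m ∈ ratRight κ M := h.2 ▸ Submodule.mem_top
  -- `alphaLeft` is `alphaRight` after swapping the factors, so the statement for `M ⊗ C` applies to
  -- the swapped tensor.
  obtain ⟨S, hS⟩ := exists_finset_alphaRight_mul κ (TensorProduct.comm R C M.carrier t)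
  refine ⟨S, fun e he => h.1 (LinearMap.ext fun b => ?_)⟩
  have : alphaLeft κ M.carrier t (e * b) = alphaLeft κ M.carrier t b := (hS e he b).2
  rw [ht] at this
  exact (M.act_mul e b m).symm.trans this

theorem locallyUnitalRight_eq_top_of_unital {M : RightMod.{u, v₁, w} R A}
    (h : ratUnitalRight κ M) : locallyUnitalRight κ M = ⊤ := by
  refine eq_top_iff.2 (le_of_eq_of_le h.1.symm (Submodule.span_le.2 ?_))
  rintro _ ⟨a, m, rfl⟩
  obtain ⟨t, ht⟩ : m ∈ ratRight κ M := h.2 ▸ Submodule.mem_top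
  obtain ⟨S, hS⟩ := exists_finset_alphaRight_mul κ (TensorProduct.comm R C M.carrier t)
  refine ⟨S, fun e he => ?_⟩
  have : alphaLeft κ M.carrier t (a * e) = alphaLeft κ M.carrier t a := (hS e he a).1
  rw [ht] at this
  exact (M.act_mul a e m).symm.trans this

theorem RightMod.isAFaithful_of_locallyUnital (hκ : HasDenseRange κ) {M : RightMod.{u, v₁, w} R A}
    (h : locallyUnitalRight κ M = ⊤) : M.IsAFaithful := by
  refine (injective_iff_map_eq_zero M.rho).2 fun m hm => ?_
  obtain ⟨S, hS⟩ : m ∈ locallyUnitalRight κ M := h ▸ Submodule.mem_top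
  obtain ⟨e, he⟩ := hκ.exists_pair_eq Coalgebra.counit S
  rw [← hS e he]
  exact LinearMap.congr_fun hm e

theorem RightMod.isUnital_of_locallyUnital (hκ : HasDenseRange κ) {M : RightMod.{u, v₁, w} R A}
    (h : locallyUnitalRight κ M = ⊤) : M.IsUnital := by
  refine eq_top_iff.2 fun m _ => ?_
  obtain ⟨S, hS⟩ : m ∈ locallyUnitalRight κ M := h ▸ Submodule.mem_top
  obtain ⟨e, he⟩ := hκ.exists_pair_eq Coalgebra.counit S
  exact Submodule.subset_span ⟨e, m, hS e he⟩

theorem ratFaithfulRight_eq_ratUnitalRight (hκ : HasDenseRange κ) :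
    ratFaithfulRight.{u, v₁, v₂, w} κ = ratUnitalRight κ := by
  funext M
  exact propext
    ⟨fun h => ⟨M.isUnital_of_locallyUnital hκ (locallyUnitalRight_eq_top_of_faithful h), h.2⟩,
    fun h => ⟨M.isAFaithful_of_locallyUnital hκ (locallyUnitalRight_eq_top_of_unital h), h.2⟩⟩

/-! Comodules as modules -/

theorem ratFaithfulRight_toRightMod (hC : IsLocallyProjective R C) (hκ : HasDenseRange κ)
    (M : LeftComod.{u, v₂, w} R C) : ratFaithfulRight κ ((toRightMod κ).obj M) :=
  ⟨(alphaLeft_injective hC hκ M.carrier).comp M.injective_coact,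
    eq_top_iff.2 fun m _ => ⟨M.coact m, rfl⟩⟩

theorem RightMod.mk_act_eq (M : RightMod.{u, v₁, w} R A) (act : A →ₗ[R] M.carrier →ₗ[R] M.carrier)
    (hmul) (h : act = M.act) : ({ carrier := M.carrier, act := act, act_mul := hmul } :
      RightMod.{u, v₁, w} R A) = M := by
  subst h
  rfl

theorem toRightMod_obj_injective (hC : IsLocallyProjective R C) (hκ : HasDenseRange κ) :
    Function.Injective (toRightMod.{u, v₁, v₂, w} κ).obj := by
  rintro ⟨M, ϱ, h₁, h₂⟩ ⟨N, ϱ', h₃, h₄⟩ h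
  injection h with hM h h' hact
  subst hM
  obtain rfl := eq_of_heq h
  obtain rfl := eq_of_heq h'
  have : ϱ = ϱ' := LinearMap.ext fun m => alphaLeft_injective hC hκ M
    (LinearMap.ext fun a => LinearMap.congr_fun (LinearMap.congr_fun (eq_of_heq hact) a) m)
  subst this
  rfl

theorem toRightMod_obj_surjective (hC : IsLocallyProjective R C) (hκ : HasDenseRange κ)
    {M : RightMod.{u, v₁, w} R A} (h : ratFaithfulRight κ M) :
    ∃ N, (toRightMod κ).obj N = M := by
  have hα := alphaLeft_injective hC hκ M.carrier
  let ϱ : M.carrier →ₗ[R] C ⊗[R] M.carrier :=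
    (LinearEquiv.ofInjective _ hα).symm.toLinearMap ∘ₗ
      M.rho.codRestrict _ fun m => (h.2 ▸ Submodule.mem_top : m ∈ ratRight κ M)
  have hϱ : ∀ m a, alphaLeft κ M.carrier (ϱ m) a = M.act a m := fun m a => by
    have := congrArg Subtype.val ((LinearEquiv.ofInjective _ hα).apply_symm_apply
      (M.rho.codRestrict _ (fun m => (h.2 ▸ Submodule.mem_top : m ∈ ratRight κ M)) m))
    exact LinearMap.congr_fun this a
  have h₁ : ∀ (t : C ⊗[R] M.carrier) (a b : A), alphaLeft κ M.carrier (alphaLeft κ _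
      (TensorProduct.assoc R C C M.carrier
        ((Coalgebra.comul (R := R) (A := C)).rTensor M.carrier t)) a) b =
      alphaLeft κ M.carrier t (a * b) := by
    intro t a b
    induction t with
    | zero => simp
    | tmul c x =>
      rw [LinearMap.rTensor_tmul, alphaLeft_tmul, pair_mul]
      induction Coalgebra.comul (R := R) c with
      | zero => simp
      | tmul y z => simp [smul_smul]
      | add y z hy hz => simp only [TensorProduct.add_tmul, map_add, LinearMap.add_apply, hy, hz,
          add_smul]
    | add x y hx hy => simp only [map_add, LinearMap.add_apply, hx, hy]
  refine ⟨⟨M.carrier, ϱ, fun m => ?_, fun m n hmn => h.1 (LinearMap.ext fun a => ?_)⟩,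
    M.mk_act_eq _ _ (LinearMap.ext fun a => LinearMap.ext fun m => hϱ m a)⟩
  -- Evaluating first at `a` and then at `b`, the two sides become `m(ab)` and `(ma)b`.
  · refine alphaLeft_injective hC hκ _ (LinearMap.ext fun a => hα (LinearMap.ext fun b => ?_))
    rw [h₁, alphaLeft_lTensor, hϱ, hϱ, hϱ, M.act_mul]
  · exact (hϱ m a).symm.trans ((congrArg (alphaLeft κ M.carrier · a) hmn).trans (hϱ n a))

theorem toRightMod_full (hC : IsLocallyProjective R C) (hκ : HasDenseRange κ) :
    (toRightMod.{u, v₁, v₂, w} κ).Full where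
  map_surjective {M N} f := ⟨⟨f.toLin, fun m => alphaLeft_injective hC hκ N.carrier
    (LinearMap.ext fun a => (f.map_act a m).symm.trans
      (alphaLeft_lTensor κ (M := M.carrier) (N := N.carrier) f.toLin (M.coact m) a).symm)⟩, rfl⟩

instance toRightMod_faithful : (toRightMod.{u, v₁, v₂, w} κ).Faithful where
  map_injective h := LeftComod.Hom.ext (congrArg RightMod.Hom.toLin h)

theorem isCategoryIso_toRightMod (hC : IsLocallyProjective R C) (hκ : HasDenseRange κ)
    (h : ∀ M : LeftComod.{u, v₂, w} R C, ratFaithfulRight κ ((toRightMod κ).obj M)) :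
    IsCategoryIso ((ratFaithfulRight κ).lift (toRightMod κ) h) := by
  have := toRightMod_full.{u, v₁, v₂, w} hC hκ
  refine IsCategoryIso.of_fullyFaithful _ ⟨fun M N hMN => ?_, fun M => ?_⟩
  · exact toRightMod_obj_injective hC hκ (congrArg ObjectProperty.FullSubcategory.obj hMN)
  · obtain ⟨N, hN⟩ := toRightMod_obj_surjective hC hκ M.property
    exact ⟨N, ObjectProperty.FullSubcategory.ext hN⟩

theorem restrict_toRightMod_obj (M : LeftComod.{u, v₂, w} R C) :
    (RightMod.restrict κ).obj ((toRightMod (dualPairing R C)).obj M) = (toRightMod κ).obj M :=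
  RightMod.mk_act_eq ((toRightMod κ).obj M) _ _
    (LinearMap.ext fun a => LinearMap.ext fun m => alphaLeft_dualPairing κ (M.coact m) a)

theorem ratFaithfulRight_restrict (hC : IsLocallyProjective R C) (hκ : HasDenseRange κ)
    (M : (ratFaithfulRight.{u, max u v₂, v₂, w} (dualPairing R C)).FullSubcategory) :
    ratFaithfulRight κ
      (((ratFaithfulRight (dualPairing R C)).ι ⋙ RightMod.restrict κ).obj M) := by
  obtain ⟨M, hM⟩ := M
  obtain ⟨N, rfl⟩ := toRightMod_obj_surjective hC hasDenseRange_dualPairing hM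
  have := ratFaithfulRight_toRightMod hC hκ N
  rwa [← restrict_toRightMod_obj] at this

theorem isCategoryIso_restrictRight (hC : IsLocallyProjective R C) (hκ : HasDenseRange κ)
    (h : ∀ M : (ratFaithfulRight.{u, max u v₂, v₂, w} (dualPairing R C)).FullSubcategory,
      ratFaithfulRight κ
        (((ratFaithfulRight (dualPairing R C)).ι ⋙ RightMod.restrict κ).obj M)) :
    IsCategoryIso ((ratFaithfulRight κ).lift
      ((ratFaithfulRight (dualPairing R C)).ι ⋙ RightMod.restrict κ) h) := by
  have hobj {M : RightMod.{u, max u v₂, w} R (ConvDual R C)}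
      (hM : ratFaithfulRight (dualPairing R C) M) :=
    toRightMod_obj_surjective hC hasDenseRange_dualPairing hM
  let F := (ratFaithfulRight κ).lift
    ((ratFaithfulRight (dualPairing R C)).ι ⋙ RightMod.restrict κ) h
  have : F.Faithful :=
    ⟨fun {M N f g} hfg => ObjectProperty.hom_ext _ (RightMod.Hom.ext
      (congrArg (fun k => RightMod.Hom.toLin (InducedCategory.Hom.hom k)) hfg))⟩
  have : F.Full := by
    refine ⟨?_⟩
    rintro ⟨M, hM⟩ ⟨N, hN⟩ f
    obtain ⟨M, rfl⟩ := hobj hM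
    obtain ⟨N, rfl⟩ := hobj hN
    -- Linearity over `A` already forces colinearity, which yields linearity over `C*`.
    let g : M ⟶ N := ⟨f.hom.toLin, fun m => alphaLeft_injective hC hκ N.carrier
      (LinearMap.ext fun a => (alphaLeft_dualPairing κ (N.coact (f.hom.toLin m)) a).symm.trans
        ((f.hom.map_act a m).symm.trans ((congrArg f.hom.toLin
          (alphaLeft_dualPairing κ (M.coact m) a)).trans
          (alphaLeft_lTensor κ (M := M.carrier) (N := N.carrier) f.hom.toLin
            (M.coact m) a).symm)))⟩
    exact ⟨ObjectProperty.homMk ((toRightMod (dualPairing R C)).map g), rfl⟩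
  refine IsCategoryIso.of_fullyFaithful F ⟨?_, ?_⟩
  · rintro ⟨M, hM⟩ ⟨N, hN⟩ hMN
    obtain ⟨M, rfl⟩ := hobj hM
    obtain ⟨N, rfl⟩ := hobj hN
    have hMN' := congrArg ObjectProperty.FullSubcategory.obj hMN
    obtain rfl : M = N := toRightMod_obj_injective hC hκ
      ((restrict_toRightMod_obj M).symm.trans (hMN'.trans (restrict_toRightMod_obj N)))
    rfl
  · rintro ⟨M, hM⟩
    obtain ⟨M, rfl⟩ := toRightMod_obj_surjective hC hκ hM
    exact ⟨⟨_, ratFaithfulRight_toRightMod hC hasDenseRange_dualPairing M⟩,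
      ObjectProperty.FullSubcategory.ext (restrict_toRightMod_obj M)⟩

/-! Subgenerated modules -/

theorem RightMod.Hom.map_mem_locallyUnital {M : RightMod.{u, v₁, w₁} R A}
    {N : RightMod.{u, v₁, w₂} R A} (f : RightMod.Hom M N) {m : M.carrier}
    (hm : m ∈ locallyUnitalRight κ M) : f.toLin m ∈ locallyUnitalRight κ N := by
  obtain ⟨S, hS⟩ := hm
  exact ⟨S, fun e he => by rw [← f.map_act, hS e he]⟩

theorem RightMod.Hom.mem_locallyUnital_of_injective {M : RightMod.{u, v₁, w₁} R A}
    {N : RightMod.{u, v₁, w₂} R A} (f : RightMod.Hom M N) (hf : Function.Injective f.toLin)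
    {m : M.carrier} (hm : f.toLin m ∈ locallyUnitalRight κ N) : m ∈ locallyUnitalRight κ M := by
  obtain ⟨S, hS⟩ := hm
  exact ⟨S, fun e he => hf (by rw [f.map_act, hS e he])⟩

theorem RightMod.Hom.map_mem_rat {M : RightMod.{u, v₁, w₁} R A}
    {N : RightMod.{u, v₁, w₂} R A} (f : RightMod.Hom M N) {m : M.carrier}
    (hm : m ∈ ratRight κ M) : f.toLin m ∈ ratRight κ N := by
  obtain ⟨t, ht⟩ := hm
  refine ⟨f.toLin.lTensor C t, LinearMap.ext fun a => ?_⟩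
  rw [alphaLeft_lTensor, ht]
  exact f.map_act a m

theorem RightMod.Hom.mem_rat_of_injective (hC : IsLocallyProjective R C) (hκ : HasDenseRange κ)
    {M : RightMod.{u, v₁, w₁} R A} {N : RightMod.{u, v₁, w₂} R A} (f : RightMod.Hom M N)
    (hf : Function.Injective f.toLin) {m : M.carrier} (hm : f.toLin m ∈ ratRight κ N) :
    m ∈ ratRight κ M := by
  have : f.toLin ∘ₗ M.rho m = N.rho (f.toLin m) := LinearMap.ext fun a => f.map_act a m
  rw [ratRight, range_alphaLeft] at hm ⊢
  exact mem_range_alphaRight_of_injective κ hC hκ hf (this ▸ hm)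

/-- The coprojections into a direct sum of copies of `K`. -/
def RightMod.copowerSingle {Λ : Type w₂} (K : RightMod.{u, v₁, w₁} R A) (i : Λ) :
    RightMod.Hom K (RightMod.copower Λ K) :=
  ⟨Finsupp.lsingle i, fun a _ => (Finsupp.mapRange_single (hf := map_zero (K.act a))).symm⟩

theorem RightMod.copower_submodule_eq_top {Λ : Type w₂} {K : RightMod.{u, v₁, w₁} R A}
    {P : Submodule R (RightMod.copower Λ K).carrier}
    (h : ∀ i x, (RightMod.copowerSingle K i).toLin x ∈ P) (x : (RightMod.copower Λ K).carrier) :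
    x ∈ P :=
  Finsupp.induction_linear x P.zero_mem (fun _ _ => P.add_mem) h

/-- `C` itself is rational and locally unital; both properties pass to sums, then to the quotient
`Q`, then to the submodule `N`. -/
theorem ratUnitalRight_of_sigma (hC : IsLocallyProjective R C) (hκ : HasDenseRange κ)
    {N : RightMod.{u, v₁, w} R A} (h : RightMod.sigma (rightC κ) N) : ratUnitalRight κ N := by
  obtain ⟨Q, Λ, p, i, hp, hi⟩ := h
  have hK : ratFaithfulRight κ (rightC κ) := ratFaithfulRight_toRightMod hC hκ _
  have hK' := locallyUnitalRight_eq_top_of_faithful hK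
  have h₁ : ∀ q, q ∈ locallyUnitalRight κ Q := fun q => by
    obtain ⟨x, rfl⟩ := hp q
    exact p.map_mem_locallyUnital (RightMod.copower_submodule_eq_top
      (fun i x => RightMod.Hom.map_mem_locallyUnital _ (hK' ▸ Submodule.mem_top)) x)
  have h₂ : ∀ q, q ∈ ratRight κ Q := fun q => by
    obtain ⟨x, rfl⟩ := hp q
    exact p.map_mem_rat (RightMod.copower_submodule_eq_top
      (fun i x => RightMod.Hom.map_mem_rat _ (hK.2 ▸ Submodule.mem_top)) x)
  exact ⟨N.isUnital_of_locallyUnital hκ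
    (eq_top_iff.2 fun n _ => i.mem_locallyUnital_of_injective hi (h₁ _)),
    eq_top_iff.2 fun n _ => i.mem_rat_of_injective hC hκ hi (h₂ _)⟩

/-- `K ⊗ M` with the action on the first factor. -/
def RightMod.tensor (M : Type w₁) [AddCommGroup M] [Module R M] (K : RightMod.{u, v₁, w₂} R A) :
    RightMod.{u, v₁, max w₁ w₂} R A where
  carrier := K.carrier ⊗[R] M
  act := LinearMap.rTensorHom M ∘ₗ K.act
  act_mul a b t := by
    induction t with
    | zero => simp
    | tmul x m => simp [K.act_mul]
    | add x y hx hy => simp only [map_add, hx, hy]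

theorem alphaLeft_rTensor_flip (M : Type w) [AddCommGroup M] [Module R M] (t : C ⊗[R] M)
    (a b : A) : alphaLeft κ M (((alphaLeft κ C ∘ₗ Coalgebra.comul).flip a).rTensor M t) b =
      alphaLeft κ M t (a * b) := by
  induction t with
  | zero => simp
  | tmul c m =>
    rw [LinearMap.rTensor_tmul, LinearMap.flip_apply, LinearMap.comp_apply, alphaLeft_tmul, alphaLeft_tmul, pair_mul]
    congr 1
    induction Coalgebra.comul (R := R) c with
    | zero => simp
    | tmul y z => simp
    | add y z hy hz => simp only [map_add, LinearMap.add_apply, hy, hz]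
  | add x y hx hy => simp only [map_add, LinearMap.add_apply, hx, hy]

/-- The coaction embeds the module into `C ⊗ M`, which the maps `c ↦ c ⊗ m` present as a quotient of
a sum of copies of `C`. -/
theorem sigma_of_ratFaithfulRight (hC : IsLocallyProjective R C) (hκ : HasDenseRange κ)
    {N : RightMod.{u, v₁, w} R A} (h : ratFaithfulRight κ N) : RightMod.sigma (rightC κ) N := by
  obtain ⟨M, rfl⟩ := toRightMod_obj_surjective hC hκ h
  let p : (ULift.{max v₂ w} M.carrier →₀ C) →ₗ[R] C ⊗[R] M.carrier :=
    Finsupp.lsum R fun m => (TensorProduct.mk R C M.carrier).flip m.down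
  have hp : ∀ m c, p (Finsupp.single m c) = c ⊗ₜ[R] m.down := fun m c => by simp [p]
  have hp' : Function.Surjective p := fun t => by
    induction t with
    | zero => exact ⟨0, map_zero p⟩
    | tmul c m => exact ⟨_, hp ⟨m⟩ c⟩
    | add x y hx hy =>
      obtain ⟨x, rfl⟩ := hx
      obtain ⟨y, rfl⟩ := hy
      exact ⟨x + y, map_add p x y⟩
  refine ⟨RightMod.tensor M.carrier (rightC κ), ULift.{max v₂ w} M.carrier, ⟨p, fun a x => ?_⟩,
    ⟨M.coact, fun a m => ?_⟩, hp', M.injective_coact⟩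
  · refine DFunLike.congr_fun (Finsupp.lhom_ext (φ := p ∘ₗ (RightMod.copower _ (rightC κ)).act a)
      (ψ := (RightMod.tensor M.carrier (rightC κ)).act a ∘ₗ p) fun m c => ?_) x
    have : (RightMod.copower _ (rightC κ)).act a (Finsupp.single m c) =
        Finsupp.single m ((rightC κ).act a c) :=
      Finsupp.mapRange_single (hf := map_zero ((rightC κ).act a))
    exact (congrArg p this).trans ((hp _ _).trans
      (congrArg ((RightMod.tensor M.carrier (rightC κ)).act a) (hp m c)).symm)
  · refine alphaLeft_injective hC hκ M.carrier (LinearMap.ext fun b => ?_)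
    exact (((toRightMod κ).obj M).act_mul a b m).symm.trans
      (alphaLeft_rTensor_flip M.carrier (M.coact m) a b).symm

theorem ratUnitalRight_eq_sigma (hC : IsLocallyProjective R C) (hκ : HasDenseRange κ) :
    ratUnitalRight.{u, v₁, v₂, w} κ = RightMod.sigma (rightC κ) := by
  funext M
  refine propext ⟨fun h => sigma_of_ratFaithfulRight hC hκ ?_, ratUnitalRight_of_sigma hC hκ⟩
  rwa [ratFaithfulRight_eq_ratUnitalRight hκ]

end RightModules

end MeasuringPairing

end

/-! ### The two chains of categories -/

theorem mainTheorem1 {R : Type u} {A : Type v₁} {C : Type v₂} [CommRing R]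
    [NonUnitalRing A] [Module R A] [IsScalarTower R A A] [SMulCommClass R A A]
    [AddCommGroup C] [Module R C] [Coalgebra R C]
    (κ : A →ₙₐ[R] ConvDual R C)
    (hC : IsLocallyProjective R C)
    (hκ : HasDenseRange κ) :
    -- every right comodule is a unital left module
    (∀ M : RightComod.{u, v₂, w} R C,
      ((toLeftMod κ).obj M).IsUnital) ∧
    -- the chain of categories over `A`
    (∃ h : ∀ M : RightComod.{u, v₂, w} R C,
        ratFaithfulLeft κ ((toLeftMod κ).obj M),
      IsCategoryIso
        ((ratFaithfulLeft κ).lift (toLeftMod κ) h)) ∧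
    ratFaithfulLeft.{u, v₁, v₂, w} κ = ratUnitalLeft κ ∧
    ratUnitalLeft.{u, v₁, v₂, w} κ =
      LeftMod.sigma (leftC κ) ∧
    -- the chain of categories over `C*`
    (∃ h : ∀ M : RightComod.{u, v₂, w} R C,
        ratFaithfulLeft (dualPairing R C)
          ((toLeftMod (dualPairing R C)).obj M),
      IsCategoryIso
        ((ratFaithfulLeft (dualPairing R C)).lift
          (toLeftMod (dualPairing R C)) h)) ∧
    ratFaithfulLeft.{u, max u v₂, v₂, w} (dualPairing R C) =
      ratUnitalLeft (dualPairing R C) ∧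
    ratUnitalLeft.{u, max u v₂, v₂, w} (dualPairing R C) =
      LeftMod.sigma
        (leftC (dualPairing R C)) ∧
    -- restriction along `κ` identifies the two chains
    (∃ h : ∀ M : (ratFaithfulLeft.{u, max u v₂, v₂, w}
          (dualPairing R C)).FullSubcategory,
        ratFaithfulLeft κ
          (((ratFaithfulLeft (dualPairing R C)).ι ⋙
            LeftMod.restrict κ).obj M),
      IsCategoryIso
        ((ratFaithfulLeft κ).lift
          ((ratFaithfulLeft (dualPairing R C)).ι ⋙
            LeftMod.restrict κ) h)) ∧
    -- the same for left comodules and right modules: every left comodule is a unital right module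
    (∀ M : LeftComod.{u, v₂, w} R C,
      ((toRightMod κ).obj M).IsUnital) ∧
    (∃ h : ∀ M : LeftComod.{u, v₂, w} R C,
        ratFaithfulRight κ ((toRightMod κ).obj M),
      IsCategoryIso
        ((ratFaithfulRight κ).lift (toRightMod κ) h)) ∧
    ratFaithfulRight.{u, v₁, v₂, w} κ = ratUnitalRight κ ∧
    ratUnitalRight.{u, v₁, v₂, w} κ =
      RightMod.sigma (rightC κ) ∧
    (∃ h : ∀ M : LeftComod.{u, v₂, w} R C,
        ratFaithfulRight (dualPairing R C)
          ((toRightMod (dualPairing R C)).obj M),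
      IsCategoryIso
        ((ratFaithfulRight (dualPairing R C)).lift
          (toRightMod (dualPairing R C)) h)) ∧
    ratFaithfulRight.{u, max u v₂, v₂, w} (dualPairing R C) =
      ratUnitalRight (dualPairing R C) ∧
    ratUnitalRight.{u, max u v₂, v₂, w} (dualPairing R C) =
      RightMod.sigma
        (rightC (dualPairing R C)) ∧
    (∃ h : ∀ M : (ratFaithfulRight.{u, max u v₂, v₂, w}
          (dualPairing R C)).FullSubcategory,
        ratFaithfulRight κ
          (((ratFaithfulRight (dualPairing R C)).ι ⋙
            RightMod.restrict κ).obj M),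
      IsCategoryIso
        ((ratFaithfulRight κ).lift
          ((ratFaithfulRight (dualPairing R C)).ι ⋙
            RightMod.restrict κ) h)) := by
  -- The pairing `(C*, C)` satisfies the hypotheses too, so the chains over `C*` are instances of
  -- those over `A`.
  have hD : HasDenseRange (dualPairing R C) := hasDenseRange_dualPairing
  have hL := ratFaithfulLeft_toLeftMod.{u, v₁, v₂, w} hC hκ
  have hLD := ratFaithfulLeft_toLeftMod.{u, max u v₂, v₂, w} hC hD
  have hR := ratFaithfulRight_toRightMod.{u, v₁, v₂, w} hC hκ
  have hRD := ratFaithfulRight_toRightMod.{u, max u v₂, v₂, w} hC hD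
  exact ⟨fun M => LeftMod.isUnital_of_locallyUnital hκ
      (locallyUnitalLeft_eq_top_of_faithful (hL M)),
    ⟨hL, isCategoryIso_toLeftMod hC hκ hL⟩,
    ratFaithfulLeft_eq_ratUnitalLeft hκ, ratUnitalLeft_eq_sigma hC hκ,
    ⟨hLD, isCategoryIso_toLeftMod hC hD hLD⟩,
    ratFaithfulLeft_eq_ratUnitalLeft hD, ratUnitalLeft_eq_sigma hC hD,
    ⟨ratFaithfulLeft_restrict hC hκ, isCategoryIso_restrictLeft hC hκ _⟩,
    fun M => RightMod.isUnital_of_locallyUnital hκ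
      (locallyUnitalRight_eq_top_of_faithful (hR M)),
    ⟨hR, isCategoryIso_toRightMod hC hκ hR⟩,
    ratFaithfulRight_eq_ratUnitalRight hκ, ratUnitalRight_eq_sigma hC hκ,
    ⟨hRD, isCategoryIso_toRightMod hC hD hRD⟩,
    ratFaithfulRight_eq_ratUnitalRight hD, ratUnitalRight_eq_sigma hC hD,
    ⟨ratFaithfulRight_restrict hC hκ, isCategoryIso_restrictRight hC hκ _⟩⟩
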